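/- **Theorem.** A bipartite pure state is a normalized vector, up to global phase, in $\mathcal H_A\otimes\mathcal H_B$ with $\mathcal H_A,\mathcal H_B$ finite-dimensional complex Hilbert spaces; its Schmidt vector consists of the squares of its Schmidt coefficients. States are composed by $(|\psi\rangle,\mathcal H_A,\mathcal H_B)\otimes(|\phi\rangle,\mathcal H_C,\mathcal H_D)$, regarded as a bipartite state on $(\mathcal H_A\otimes\mathcal H_C)\otimes(\mathcal H_B\otimes\mathcal H_D)$. Write $|\psi\rangle\to_{LOCC}|\phi\rangle$ if some LOCC channel (finitely many rounds of local quantum operations and classical communication) sends $|\psi\rangle$ to $|\phi\rangle$ with certainty. For a state $C$ and a nonempty set $S$ of states let $$Cat_{LOCC}(C)=\{(A,B): A\otimes C\to_{LOCC} B\otimes C\},$$ $$Cat^{(f)}_{LOCC}(S)=\{(A,B): \forall C\in S\ \exists C'\in S,\ A\otimes C\to_{LOCC} B\otimes C'\}.$$ Then there exists a set $S$ of exactly two bipartite pure states such that flexible LOCC catalysis with catalyst set $S$ achieves a conversion that no single element of $S$ achieves as an ordinary catalyst, that is, $$Cat^{(f)}_{LOCC}(S)\setminus\bigcup_{C\in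 S}Cat_{LOCC}(C)\neq\emptyset .$$ More precisely, there are bipartite pure states $|\psi_1\rangle,|\psi_2\rangle$ with Schmidt vectors $(0.4,0.4,0.1,0.1)$ and $(0.5,0.29,0.21,0)$, respectively, such that, for $S=\{|\psi_1\rangle,|\psi_2\rangle\}$, $$(|\psi_1\rangle,|\psi_2\rangle)\in Cat^{(f)}_{LOCC}(S)\setminus\bigcup_{C\in S}Cat_{LOCC}(C).$$ -/

import Mathlib

open scoped Kronecker

/-- The operator `|ψ⟩⟨ψ|` of a vector `ψ` of the Hilbert space `ℂ^ι`. -/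
def ketbra {ι : Type} (ψ : EuclideanSpace ℂ ι) : Matrix ι ι ℂ :=
  Matrix.of fun i j => ψ i * star (ψ j)

/-- A bipartite pure quantum state on `ℂ^A ⊗ ℂ^B = ℂ^(A × B)`, where `A` and `B` are finite index
sets of orthonormal bases.  A normalized vector up to global phase is the same thing as its
projector `|ψ⟩⟨ψ|`, so the state is stored as that projector. -/
structure BipartiteState where
  A : Type
  B : Type
  [fintypeA : Fintype A]
  [fintypeB : Fintype B]
  [decEqA : DecidableEq A]
  [decEqB : DecidableEq B]
  /-- the projector onto the state -/
  proj : Matrix (A × B) (A × B) ℂ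
  isPure : ∃ ψ : EuclideanSpace ℂ (A × B), ‖ψ‖ = 1 ∧ proj = ketbra ψ

attribute [instance] BipartiteState.fintypeA BipartiteState.fintypeB
  BipartiteState.decEqA BipartiteState.decEqB

/-- Tensor product of operators on `ℂ^A ⊗ ℂ^B` and `ℂ^C ⊗ ℂ^D`, with the two middle factors
swapped, so that it acts on `(ℂ^A ⊗ ℂ^C) ⊗ (ℂ^B ⊗ ℂ^D)`. -/
def bipartiteKronecker {A B C D : Type} (M : Matrix (A × B) (A × B) ℂ)
    (N : Matrix (C × D) (C × D) ℂ) : Matrix ((A × C) × (B × D)) ((A × C) × (B × D)) ℂ :=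
  Matrix.reindex (Equiv.prodProdProdComm A B C D) (Equiv.prodProdProdComm A B C D) (M ⊗ₖ N)

theorem bipartiteKronecker_isPure {A B C D : Type} [Fintype A] [Fintype B] [Fintype C] [Fintype D]
    {M : Matrix (A × B) (A × B) ℂ} {N : Matrix (C × D) (C × D) ℂ}
    (hM : ∃ ψ : EuclideanSpace ℂ (A × B), ‖ψ‖ = 1 ∧ M = ketbra ψ)
    (hN : ∃ φ : EuclideanSpace ℂ (C × D), ‖φ‖ = 1 ∧ N = ketbra φ) :
    ∃ χ : EuclideanSpace ℂ ((A × C) × (B × D)), ‖χ‖ = 1 ∧ bipartiteKronecker M N = ketbra χ := by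
  obtain ⟨ψ, hψ, rfl⟩ := hM
  obtain ⟨φ, hφ, rfl⟩ := hN
  refine ⟨WithLp.toLp 2 fun i => ψ (i.1.1, i.2.1) * φ (i.1.2, i.2.2), ?_, ?_⟩
  · rw [EuclideanSpace.norm_eq, Real.sqrt_eq_one] at hψ hφ ⊢
    rw [← Equiv.sum_comp (Equiv.prodProdProdComm A B C D), Fintype.sum_prod_type]
    simp only [Equiv.prodProdProdComm_apply, norm_mul, mul_pow]
    rw [← Finset.sum_mul_sum, hψ, hφ, mul_one]
  · ext i j
    simp [bipartiteKronecker, ketbra, Matrix.kroneckerMap_apply, mul_mul_mul_comm]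

/-- Composition of two bipartite states: Alice holds both first factors, Bob both second ones. -/
def BipartiteState.tensor (s t : BipartiteState) : BipartiteState where
  A := s.A × t.A
  B := s.B × t.B
  proj := bipartiteKronecker s.proj t.proj
  isPure := bipartiteKronecker_isPure s.isPure t.isPure

/-- The Kraus map `M ↦ K M Kᴴ`. -/
def krausMap {m n : Type} [Fintype n] (K : Matrix m n ℂ) : Matrix n n ℂ →ₗ[ℂ] Matrix m m ℂ where
  toFun M := K * M * K.conjTranspose
  map_add' M N := by rw [Matrix.mul_add, Matrix.add_mul]
  map_smul' c M := by simp

/-- The (finite-round) LOCC channels from operators on `ℂ^A ⊗ ℂ^B` to operators on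
`ℂ^X ⊗ ℂ^Y`.  A protocol either stops, or one party applies a local quantum instrument and
communicates the classical outcome `k`, after which the parties continue with an LOCC protocol
that may depend on `k`.  The instrument has the completely positive maps `M ↦ ∑ j, K k j M (K k j)ᴴ`,
whose sum over `k` is trace preserving.  A local channel is an instrument with one outcome. -/
inductive IsLOCC {X Y : Type} [Fintype X] [Fintype Y] [DecidableEq X] [DecidableEq Y] :
    ∀ (A B : Type) [Fintype A] [Fintype B] [DecidableEq A] [DecidableEq B],
      (Matrix (A × B) (A × B) ℂ →ₗ[ℂ] Matrix (X × Y) (X × Y) ℂ) → Prop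
  | done : IsLOCC X Y LinearMap.id
  | alice (A B A' κ ι : Type) [Fintype A] [Fintype B] [DecidableEq A] [DecidableEq B]
      [Fintype A'] [DecidableEq A'] [Fintype κ] [Fintype ι]
      (K : κ → ι → Matrix A' A ℂ)
      (Φ : κ → (Matrix (A' × B) (A' × B) ℂ →ₗ[ℂ] Matrix (X × Y) (X × Y) ℂ))
      (hK : ∑ k, ∑ j, (K k j).conjTranspose * K k j = 1)
      (hΦ : ∀ k, IsLOCC A' B (Φ k)) :
      IsLOCC A B (∑ k, Φ k ∘ₗ ∑ j, krausMap (K k j ⊗ₖ (1 : Matrix B B ℂ)))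
  | bob (A B B' κ ι : Type) [Fintype A] [Fintype B] [DecidableEq A] [DecidableEq B]
      [Fintype B'] [DecidableEq B'] [Fintype κ] [Fintype ι]
      (K : κ → ι → Matrix B' B ℂ)
      (Φ : κ → (Matrix (A × B') (A × B') ℂ →ₗ[ℂ] Matrix (X × Y) (X × Y) ℂ))
      (hK : ∑ k, ∑ j, (K k j).conjTranspose * K k j = 1)
      (hΦ : ∀ k, IsLOCC A B' (Φ k)) :
      IsLOCC A B (∑ k, Φ k ∘ₗ ∑ j, krausMap ((1 : Matrix A A ℂ) ⊗ₖ K k j))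

/-- `s` can be transformed into `t` (with certainty) by some LOCC channel. -/
def LOCCTransforms (s t : BipartiteState) : Prop :=
  ∃ Φ : Matrix (s.A × s.B) (s.A × s.B) ℂ →ₗ[ℂ] Matrix (t.A × t.B) (t.A × t.B) ℂ,
    IsLOCC s.A s.B Φ ∧ Φ s.proj = t.proj

/-- The transformations `(s, t)` that LOCC achieves with the ordinary catalyst `c`. -/
def catLOCC (c : BipartiteState) : Set (BipartiteState × BipartiteState) :=
  {p | LOCCTransforms (p.1.tensor c) (p.2.tensor c)}

/-- The transformations `(s, t)` that LOCC achieves flexibly with the catalyst set `S`. -/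
def flexCatLOCC (S : Set BipartiteState) : Set (BipartiteState × BipartiteState) :=
  {p | ∀ c ∈ S, ∃ c' ∈ S, LOCCTransforms (p.1.tensor c) (p.2.tensor c')}

/-- `p` is a Schmidt vector of `s`, i.e. `s` has a Schmidt decomposition
`∑ i, √(p i) |α i⟩ |β i⟩` with `d = min (dim H_A) (dim H_B)` terms.  The entries of the Schmidt
vector are the squares of the Schmidt coefficients. -/
def HasSchmidtVector (s : BipartiteState) {d : ℕ} (p : Fin d → ℝ) : Prop :=
  d = min (Fintype.card s.A) (Fintype.card s.B) ∧ (∀ i, 0 ≤ p i) ∧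
    ∃ (α : Fin d → EuclideanSpace ℂ s.A) (β : Fin d → EuclideanSpace ℂ s.B),
      Orthonormal ℂ α ∧ Orthonormal ℂ β ∧
        s.proj = ketbra (WithLp.toLp 2 fun x : s.A × s.B =>
          ∑ i, (Real.sqrt (p i) : ℂ) * α i x.1 * β i x.2)

/-! Write p and q for the two Schmidt vectors. Both flexible conversions exist for simple reasons:
from catalyst ψ₂, exchanging the two factors on each side takes ψ₁ ⊗ ψ₂ to ψ₂ ⊗ ψ₁
(`locctransforms_tensor_comm`); from catalyst ψ₁, q ⊗ q majorizes p ⊗ p, so ψ₁ ⊗ ψ₁ goes to ψ₂ ⊗ ψ₂.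
The latter uses Birkhoff's theorem and the sufficiency half of Nielsen's theorem
(`exists_isLOCC_of_mixture`).

An ordinary catalyst fails because majorization fails: the top four entries of p ⊗ p sum to more
than those of q ⊗ p, and the top two of p ⊗ q to more than those of q ⊗ q. That this excludes every
LOCC channel rests on `KyFanLE.of_isLOCC`: an upper bound on the sum of the k largest squared
Schmidt coefficients passes from the target back to the source. A channel splits a pure input into
unnormalized pure branches, bounds on the branches add up, and a pure output forces each branch to
be a multiple of it. -/

/-! ### Pure states as coefficient matrices -/

/-- The vector `∑ M a b |a⟩|b⟩` with coefficient matrix `M`. -/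
def bipartiteVec {A B : Type} (M : Matrix A B ℂ) : EuclideanSpace ℂ (A × B) :=
  WithLp.toLp 2 fun x => M x.1 x.2

theorem inner_bipartiteVec {A B : Type} [Fintype A] [Fintype B] (X M : Matrix A B ℂ) :
    inner ℂ (bipartiteVec X) (bipartiteVec M) = (X.conjTranspose * M).trace := by
  simp only [bipartiteVec, PiLp.inner_apply, Matrix.trace, Matrix.diag, Matrix.mul_apply,
    Matrix.conjTranspose_apply, Fintype.sum_prod_type, RCLike.inner_apply]
  rw [Finset.sum_comm]
  exact Finset.sum_congr rfl fun _ _ => Finset.sum_congr rfl fun _ _ => mul_comm _ _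

theorem norm_sq_bipartiteVec {A B : Type} [Fintype A] [Fintype B] (M : Matrix A B ℂ) :
    ((‖bipartiteVec M‖ ^ 2 : ℝ) : ℂ) = (M.conjTranspose * M).trace := by
  rw [← inner_bipartiteVec, inner_self_eq_norm_sq_to_K]
  simp

theorem bipartiteVec_transpose_norm {A B : Type} [Fintype A] [Fintype B] (M : Matrix A B ℂ) :
    ‖bipartiteVec M.transpose‖ = ‖bipartiteVec M‖ := by
  rw [EuclideanSpace.norm_eq, EuclideanSpace.norm_eq]
  congr 1
  rw [Fintype.sum_prod_type, Fintype.sum_prod_type_right]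
  rfl

theorem inner_bipartiteVec_transpose {A B : Type} [Fintype A] [Fintype B] (X M : Matrix A B ℂ) :
    inner ℂ (bipartiteVec X.transpose) (bipartiteVec M.transpose) =
      inner ℂ (bipartiteVec X) (bipartiteVec M) := by
  simp only [PiLp.inner_apply]
  rw [Fintype.sum_prod_type, Fintype.sum_prod_type_right]
  rfl

theorem krausMap_ketbra {m n : Type} [Fintype n] (K : Matrix m n ℂ) (ψ : EuclideanSpace ℂ n) :
    krausMap K (ketbra ψ) = ketbra (WithLp.toLp 2 (K.mulVec ψ.ofLp)) := by
  ext i j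
  simp only [krausMap, ketbra, LinearMap.coe_mk, AddHom.coe_mk, Matrix.mul_apply, Matrix.of_apply,
    Matrix.conjTranspose_apply, Matrix.mulVec, dotProduct, star_sum, Finset.sum_mul, Finset.mul_sum,
    star_mul']
  exact Finset.sum_congr rfl fun _ _ => Finset.sum_congr rfl fun _ _ => by ring

theorem krausMap_alice {A B A' : Type} [Fintype A] [Fintype B] [DecidableEq B]
    (K : Matrix A' A ℂ) (M : Matrix A B ℂ) :
    krausMap (K ⊗ₖ (1 : Matrix B B ℂ)) (ketbra (bipartiteVec M)) =
      ketbra (bipartiteVec (K * M)) := by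
  rw [krausMap_ketbra]
  congr 1
  ext x
  simp [bipartiteVec, Matrix.mulVec, dotProduct, Fintype.sum_prod_type, Matrix.mul_apply,
    Matrix.one_apply]

theorem krausMap_bob {A B B' : Type} [Fintype A] [Fintype B] [DecidableEq A]
    (K : Matrix B' B ℂ) (M : Matrix A B ℂ) :
    krausMap ((1 : Matrix A A ℂ) ⊗ₖ K) (ketbra (bipartiteVec M)) =
      ketbra (bipartiteVec (M * K.transpose)) := by
  rw [krausMap_ketbra]
  congr 1
  ext x
  simp [bipartiteVec, Matrix.mulVec, dotProduct, Fintype.sum_prod_type, Matrix.mul_apply,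
    Matrix.one_apply, mul_comm]

theorem bipartiteKronecker_ketbra {A B C D : Type} (M : Matrix A B ℂ) (N : Matrix C D ℂ) :
    bipartiteKronecker (ketbra (bipartiteVec M)) (ketbra (bipartiteVec N)) =
      ketbra (bipartiteVec (M ⊗ₖ N)) := by
  ext i j
  simp [bipartiteKronecker, ketbra, bipartiteVec, Matrix.kroneckerMap_apply, mul_mul_mul_comm]

/-! ### Ky Fan bounds through low-rank overlaps -/

open scoped ComplexOrder in
/-- The Hermitian projection onto the row space of a matrix. -/
theorem exists_rowSpace_projection {A B : Type} [Fintype A] [Fintype B] [DecidableEq A]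
    (X : Matrix A B ℂ) :
    ∃ P : Matrix B B ℂ, P.conjTranspose = P ∧ P * P = P ∧ P.rank ≤ X.rank ∧
      P.trace = X.rank ∧ X * P = X := by
  classical
  let W : Submodule ℂ (EuclideanSpace ℂ B) :=
    LinearMap.range (Matrix.toEuclideanLin X.conjTranspose)
  have hW : Module.finrank ℂ W = X.rank := by
    rw [← Matrix.rank_conjTranspose, Matrix.rank_eq_finrank_range_toLin _
      (EuclideanSpace.basisFun B ℂ).toBasis (EuclideanSpace.basisFun A ℂ).toBasis]
    rw [← Matrix.toEuclideanLin_eq_toLin_orthonormal]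
  let b := stdOrthonormalBasis ℂ W
  let Q : Matrix B (Fin (Module.finrank ℂ W)) ℂ := Matrix.of fun x i => (b i : EuclideanSpace ℂ B) x
  have hQ : Q.conjTranspose * Q = 1 := by
    ext i j
    have := orthonormal_iff_ite.1 b.orthonormal i j
    rw [Submodule.coe_inner, PiLp.inner_apply] at this
    rw [Matrix.one_apply, ← this, Matrix.mul_apply]
    exact Finset.sum_congr rfl fun x _ => by simp [Q, mul_comm]
  -- The columns of `X.conjTranspose` lie in `W`, so expanding them in the basis `b` recovers them.
  have hX : Q * Q.conjTranspose * X.conjTranspose = X.conjTranspose := by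
    ext x a
    let y : W := ⟨Matrix.toEuclideanLin X.conjTranspose (EuclideanSpace.single a 1),
      LinearMap.mem_range_self _ _⟩
    have hy : ∀ z, (y : EuclideanSpace ℂ B) z = X.conjTranspose z a := by
      intro z
      simp [y, Matrix.toLpLin_apply]
    have h := congrArg (fun v : W => (v : EuclideanSpace ℂ B) x) (b.sum_repr' y)
    simp only [hy] at h
    rw [← h, Matrix.mul_assoc, Matrix.mul_apply]
    simp only [Submodule.coe_sum, Submodule.coe_smul, WithLp.ofLp_sum, Finset.sum_apply,
      PiLp.smul_apply, smul_eq_mul]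
    refine Finset.sum_congr rfl fun i _ => ?_
    rw [mul_comm, Matrix.mul_apply, Submodule.coe_inner, PiLp.inner_apply]
    congr 1
    exact Finset.sum_congr rfl fun z _ => by rw [hy]; simp [Q, mul_comm]
  refine ⟨Q * Q.conjTranspose, by simp, ?_, ?_, ?_, ?_⟩
  · rw [Matrix.mul_assoc, ← Matrix.mul_assoc Q.conjTranspose, hQ, Matrix.one_mul]
  · refine (Matrix.rank_mul_le_left _ _).trans ?_
    rw [← hW]
    simpa using Matrix.rank_le_card_width Q
  · rw [Matrix.trace_mul_comm, hQ, Matrix.trace_one, Fintype.card_fin, hW]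
  · have := congrArg Matrix.conjTranspose hX
    simpa [Matrix.mul_assoc] using this

/-- The sum of the `k` largest squared Schmidt coefficients of `M` is at most `c`, phrased through
the overlaps of `M` with vectors of Schmidt rank at most `k`. -/
def KyFanLE {A B : Type} [Fintype A] [Fintype B] (k : ℕ) (M : Matrix A B ℂ) (c : ℝ) : Prop :=
  0 ≤ c ∧ ∀ X : Matrix A B ℂ, X.rank ≤ k →
    ‖inner ℂ (bipartiteVec X) (bipartiteVec M)‖ ^ 2 ≤ c * ‖bipartiteVec X‖ ^ 2

theorem KyFanLE.transpose {A B : Type} [Fintype A] [Fintype B] {k : ℕ} {M : Matrix A B ℂ} {c : ℝ}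
    (h : KyFanLE k M c) : KyFanLE k M.transpose c := by
  refine ⟨h.1, fun X hX => ?_⟩
  have := h.2 X.transpose (by rwa [Matrix.rank_transpose])
  rwa [← inner_bipartiteVec_transpose, bipartiteVec_transpose_norm, Matrix.transpose_transpose]
    at this

theorem inner_mul_projection {A B : Type} [Fintype A] [Fintype B] (X M : Matrix A B ℂ)
    {P : Matrix B B ℂ} (hP : P.conjTranspose = P) :
    inner ℂ (bipartiteVec (X * P)) (bipartiteVec M) =
      inner ℂ (bipartiteVec X) (bipartiteVec (M * P)) := by
  rw [inner_bipartiteVec, inner_bipartiteVec, Matrix.conjTranspose_mul, hP, Matrix.mul_assoc,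
    Matrix.trace_mul_comm, Matrix.mul_assoc]

/-- It suffices to bound the compressions of `M` by projections on the second factor. -/
theorem KyFanLE.of_projection {A B : Type} [Fintype A] [Fintype B] {k : ℕ}
    {M : Matrix A B ℂ} {c : ℝ} (hc : 0 ≤ c)
    (h : ∀ P : Matrix B B ℂ, P.conjTranspose = P → P * P = P → P.rank ≤ k → P.trace.re ≤ k →
      ‖bipartiteVec (M * P)‖ ^ 2 ≤ c) : KyFanLE k M c := by
  classical
  refine ⟨hc, fun X hX => ?_⟩
  obtain ⟨P, hP, hPP, hr, ht, hXP⟩ := exists_rowSpace_projection X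
  have h1 : inner ℂ (bipartiteVec X) (bipartiteVec M) =
      inner ℂ (bipartiteVec X) (bipartiteVec (M * P)) := by
    rw [← inner_mul_projection X M hP, hXP]
  rw [h1]
  have h2 := norm_inner_le_norm (𝕜 := ℂ) (bipartiteVec X) (bipartiteVec (M * P))
  have h3 := h P hP hPP (hr.trans hX) (by rw [ht]; exact_mod_cast hX)
  calc _ ≤ (‖bipartiteVec X‖ * ‖bipartiteVec (M * P)‖) ^ 2 := by gcongr
    _ = ‖bipartiteVec (M * P)‖ ^ 2 * ‖bipartiteVec X‖ ^ 2 := by ring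
    _ ≤ _ := by gcongr

/-- Converse of `KyFanLE.of_projection`: test with `X = M * P`, whose overlap with `M` is its own
squared norm, and cancel one factor. -/
theorem KyFanLE.norm_mul_projection_le {A B : Type} [Fintype A] [Fintype B] {k : ℕ}
    {M : Matrix A B ℂ} {c : ℝ} (h : KyFanLE k M c) {P : Matrix B B ℂ}
    (hP : P.conjTranspose = P) (hPP : P * P = P) (hr : P.rank ≤ k) :
    ‖bipartiteVec (M * P)‖ ^ 2 ≤ c := by
  have h1 := h.2 (M * P) ((Matrix.rank_mul_le_right _ _).trans hr)
  have h2 : inner ℂ (bipartiteVec (M * P)) (bipartiteVec M) =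
      ((‖bipartiteVec (M * P)‖ ^ 2 : ℝ) : ℂ) := by
    rw [norm_sq_bipartiteVec, ← inner_bipartiteVec, inner_mul_projection M M hP,
      inner_mul_projection M (M * P) hP, Matrix.mul_assoc, hPP]
  rw [h2, Complex.norm_real, Real.norm_eq_abs, sq_abs] at h1
  by_contra! hlt
  nlinarith [h.1, mul_lt_mul_of_pos_right hlt (h.1.trans_lt hlt)]

/-! ### Monotonicity under LOCC -/

theorem sum_norm_sq_kraus {A B A' ι : Type} [Fintype A] [Fintype B] [Fintype A'] [Fintype ι]
    [DecidableEq A] (K : ι → Matrix A' A ℂ) (hK : ∑ j, (K j).conjTranspose * K j = 1)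
    (N : Matrix A B ℂ) : ∑ j, ‖bipartiteVec (K j * N)‖ ^ 2 = ‖bipartiteVec N‖ ^ 2 := by
  have : ((∑ j, ‖bipartiteVec (K j * N)‖ ^ 2 : ℝ) : ℂ) = ((‖bipartiteVec N‖ ^ 2 : ℝ) : ℂ) := by
    rw [Complex.ofReal_sum]
    simp_rw [norm_sq_bipartiteVec]
    rw [← Matrix.trace_sum]
    congr 1
    calc _ = N.conjTranspose * (∑ j, (K j).conjTranspose * K j) * N := by
          simp only [Matrix.conjTranspose_mul, Matrix.mul_sum, Matrix.sum_mul, Matrix.mul_assoc]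
      _ = _ := by rw [hK, Matrix.mul_one]
  exact_mod_cast this

/-- Alice's operators act on the left of `M` and the projection on the right, so one `P` serves all
outcomes while the squared norms add up to that of `M * P`. -/
theorem KyFanLE.of_alice {A B A' ι : Type} [Fintype A] [Fintype B] [Fintype A'] [Fintype ι]
    [DecidableEq A] {k : ℕ} {K : ι → Matrix A' A ℂ} (hK : ∑ j, (K j).conjTranspose * K j = 1)
    {M : Matrix A B ℂ} {c : ι → ℝ} (h : ∀ j, KyFanLE k (K j * M) (c j)) :
    KyFanLE k M (∑ j, c j) := by
  refine .of_projection (Finset.sum_nonneg fun j _ => (h j).1) fun P hP hPP hr _ => ?_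
  rw [← sum_norm_sq_kraus K hK]
  refine Finset.sum_le_sum fun j _ => ?_
  rw [← Matrix.mul_assoc]
  exact (h j).norm_mul_projection_le hP hPP hr

theorem KyFanLE.of_bob {A B B' ι : Type} [Fintype A] [Fintype B] [Fintype B'] [Fintype ι]
    [DecidableEq B] {k : ℕ} {K : ι → Matrix B' B ℂ} (hK : ∑ j, (K j).conjTranspose * K j = 1)
    {M : Matrix A B ℂ} {c : ι → ℝ} (h : ∀ j, KyFanLE k (M * (K j).transpose) (c j)) :
    KyFanLE k M (∑ j, c j) := by
  have := KyFanLE.of_alice hK (M := M.transpose) (c := c) fun j => by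
    simpa using (h j).transpose
  simpa using this.transpose

/-- The branches are unnormalized, one per sequence of Kraus operators, so probabilities are
absorbed in the norms and the bounds simply add along the protocol tree. -/
theorem IsLOCC.exists_branches {X Y : Type} [Fintype X] [Fintype Y] [DecidableEq X]
    [DecidableEq Y] (k : ℕ) {A B : Type} [Fintype A] [Fintype B] [DecidableEq A] [DecidableEq B]
    {Φ : Matrix (A × B) (A × B) ℂ →ₗ[ℂ] Matrix (X × Y) (X × Y) ℂ} (hΦ : IsLOCC A B Φ)
    (M : Matrix A B ℂ) :
    ∃ (ι : Type) (_ : Fintype ι) (N : ι → Matrix X Y ℂ),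
      Φ (ketbra (bipartiteVec M)) = ∑ l, ketbra (bipartiteVec (N l)) ∧
        ∀ c : ι → ℝ, (∀ l, KyFanLE k (N l) (c l)) → KyFanLE k M (∑ l, c l) := by
  induction hΦ with
  | done => exact ⟨Unit, inferInstance, fun _ => M, by simp, fun c h => by simpa using h ()⟩
  | alice A B A' κ ι K Φ hK hΦ ih =>
    choose τ hτ N hN hc using fun (x : κ × ι) => ih x.1 (K x.1 x.2 * M)
    refine ⟨Σ x, τ x, inferInstance, fun l => N l.1 l.2, ?_, fun c h => ?_⟩
    · simp only [LinearMap.sum_apply, LinearMap.comp_apply, krausMap_alice, map_sum]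
      rw [Fintype.sum_sigma, Fintype.sum_prod_type]
      simp only [← hN]
    · rw [Fintype.sum_sigma]
      exact KyFanLE.of_alice (K := fun x : κ × ι => K x.1 x.2)
        (by rw [Fintype.sum_prod_type]; exact hK) fun x => hc x _ fun l => h ⟨x, l⟩
  | bob A B B' κ ι K Φ hK hΦ ih =>
    choose τ hτ N hN hc using fun (x : κ × ι) => ih x.1 (M * (K x.1 x.2).transpose)
    refine ⟨Σ x, τ x, inferInstance, fun l => N l.1 l.2, ?_, fun c h => ?_⟩
    · simp only [LinearMap.sum_apply, LinearMap.comp_apply, krausMap_bob, map_sum]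
      rw [Fintype.sum_sigma, Fintype.sum_prod_type]
      simp only [← hN]
    · rw [Fintype.sum_sigma]
      exact KyFanLE.of_bob (K := fun x : κ × ι => K x.1 x.2)
        (by rw [Fintype.sum_prod_type]; exact hK) fun x => hc x _ fun l => h ⟨x, l⟩

theorem inner_ketbra_mulVec {n : Type} [Fintype n] (v ψ : EuclideanSpace ℂ n) :
    (dotProduct (star v.ofLp) ((ketbra ψ).mulVec v.ofLp)) = ((‖inner ℂ v ψ‖ ^ 2 : ℝ) : ℂ) := by
  have h : inner ℂ v ψ = ∑ i, star (v i) * ψ i := by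
    rw [PiLp.inner_apply]
    exact Finset.sum_congr rfl fun i _ => by simp [mul_comm]
  rw [← Complex.normSq_eq_norm_sq, ← Complex.mul_conj, h, map_sum, Finset.sum_mul_sum]
  simp only [dotProduct, Matrix.mulVec, ketbra, Matrix.of_apply, Finset.mul_sum]
  exact Finset.sum_congr rfl fun i _ => Finset.sum_congr rfl fun j _ => by
    simp; ring

/-- A decomposition of a pure state consists of multiples of that state. -/
theorem exists_smul_of_sum_ketbra {n ι : Type} [Fintype n] [Fintype ι] {φ : EuclideanSpace ℂ n}
    (hφ : ‖φ‖ = 1) {χ : ι → EuclideanSpace ℂ n} (h : ketbra φ = ∑ l, ketbra (χ l)) :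
    ∃ a : ι → ℂ, (∀ l, χ l = a l • φ) ∧ ∑ l, ‖a l‖ ^ 2 = 1 := by
  have key : ∀ v, ‖inner ℂ v φ‖ ^ 2 = ∑ l, ‖inner ℂ v (χ l)‖ ^ 2 := by
    intro v
    have : ((‖inner ℂ v φ‖ ^ 2 : ℝ) : ℂ) = ((∑ l, ‖inner ℂ v (χ l)‖ ^ 2 : ℝ) : ℂ) := by
      rw [Complex.ofReal_sum]
      simp_rw [← inner_ketbra_mulVec]
      rw [h, Matrix.sum_mulVec, dotProduct_sum]
    exact_mod_cast this
  refine ⟨fun l => inner ℂ φ (χ l), fun l => ?_, ?_⟩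
  -- The part of `χ l` orthogonal to `φ`: testing `key` against it makes the left side vanish, hence
  -- every term on the right.
  · set v := χ l - inner ℂ φ (χ l) • φ with hv
    have hφφ : inner ℂ φ φ = (1 : ℂ) := by rw [inner_self_eq_norm_sq_to_K, hφ]; simp
    have h0 : inner ℂ φ v = 0 := by
      rw [hv, inner_sub_right, inner_smul_right, hφφ, mul_one, sub_self]
    have h0' : inner ℂ v φ = 0 := inner_eq_zero_symm.1 h0
    have h1 := key v
    rw [h0', norm_zero, zero_pow two_ne_zero, eq_comm,
      Finset.sum_eq_zero_iff_of_nonneg fun _ _ => by positivity] at h1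
    have h2 : inner ℂ v (χ l) = 0 := by simpa using h1 l (Finset.mem_univ _)
    have h3 : inner ℂ v v = 0 := by
      nth_rw 2 [hv]
      rw [inner_sub_right, inner_smul_right, h2, h0', mul_zero, sub_zero]
    exact sub_eq_zero.1 (inner_self_eq_zero.1 h3)
  · rw [← key φ, inner_self_eq_norm_sq_to_K, hφ]
    simp

theorem KyFanLE.smul {A B : Type} [Fintype A] [Fintype B] {k : ℕ} {M : Matrix A B ℂ} {c : ℝ}
    (h : KyFanLE k M c) (a : ℂ) : KyFanLE k (a • M) (‖a‖ ^ 2 * c) := by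
  refine ⟨mul_nonneg (by positivity) h.1, fun X hX => ?_⟩
  have : bipartiteVec (a • M) = a • bipartiteVec M := rfl
  rw [this, inner_smul_right, norm_mul, mul_pow, mul_assoc]
  exact mul_le_mul_of_nonneg_left (h.2 X hX) (by positivity)

/-- The Ky Fan functionals do not decrease under LOCC. -/
theorem KyFanLE.of_isLOCC {A B X Y : Type} [Fintype A] [Fintype B] [DecidableEq A]
    [DecidableEq B] [Fintype X] [Fintype Y] [DecidableEq X] [DecidableEq Y] {k : ℕ}
    {Φ : Matrix (A × B) (A × B) ℂ →ₗ[ℂ] Matrix (X × Y) (X × Y) ℂ} (hΦ : IsLOCC A B Φ)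
    {M : Matrix A B ℂ} {N : Matrix X Y ℂ} (hN : ‖bipartiteVec N‖ = 1)
    (h : Φ (ketbra (bipartiteVec M)) = ketbra (bipartiteVec N)) {c : ℝ} (hc : KyFanLE k N c) :
    KyFanLE k M c := by
  obtain ⟨ι, _, L, hL, hk⟩ := hΦ.exists_branches k M
  obtain ⟨a, ha, ha1⟩ := exists_smul_of_sum_ketbra hN (h.symm.trans hL)
  have := hk (fun l => ‖a l‖ ^ 2 * c) fun l => by
    have hl : L l = a l • N := by
      ext i j
      exact congrArg (fun v : EuclideanSpace ℂ (X × Y) => v (i, j)) (ha l)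
    rw [hl]
    exact hc.smul _
  rwa [← Finset.sum_mul, ha1, one_mul] at this

/-! ### Ky Fan bounds for diagonal states -/

/-- The diagonal coefficient matrix with Schmidt vector `p`. -/
noncomputable def schmidtMatrix {A : Type} [DecidableEq A] (p : A → ℝ) : Matrix A A ℂ :=
  Matrix.diagonal fun i => (Real.sqrt (p i) : ℂ)

theorem norm_schmidtMatrix {A : Type} [Fintype A] [DecidableEq A] {p : A → ℝ}
    (hp : ∀ i, 0 ≤ p i) : ‖bipartiteVec (schmidtMatrix p)‖ ^ 2 = ∑ i, p i := by
  have : ((‖bipartiteVec (schmidtMatrix p)‖ ^ 2 : ℝ) : ℂ) = ((∑ i, p i : ℝ) : ℂ) := by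
    rw [norm_sq_bipartiteVec, schmidtMatrix, Matrix.diagonal_conjTranspose,
      Matrix.diagonal_mul_diagonal, Matrix.trace_diagonal, Complex.ofReal_sum]
    refine Finset.sum_congr rfl fun i _ => ?_
    simp only [Pi.star_apply, RCLike.star_def, Complex.conj_ofReal]
    rw [← Complex.ofReal_mul, Real.mul_self_sqrt (hp i)]
  exact_mod_cast this

theorem schmidtMatrix_kronecker {A B : Type} [DecidableEq A] [DecidableEq B] {p : A → ℝ}
    {q : B → ℝ} (hp : ∀ i, 0 ≤ p i) :
    schmidtMatrix p ⊗ₖ schmidtMatrix q = schmidtMatrix fun x : A × B => p x.1 * q x.2 := by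
  simp [schmidtMatrix, Matrix.diagonal_kronecker_diagonal, Real.sqrt_mul (hp _)]

/-- Weak linear programming duality: the diagonal of a projection has entries in [0, 1] with sum at
most `k`, and `θ` is the multiplier of the sum constraint. Choosing `θ` as a `k`-th largest entry
gives the exact top-`k` sum without sorting. -/
theorem kyFanLE_schmidtMatrix {A : Type} [Fintype A] [DecidableEq A] {q : A → ℝ}
    (hq : ∀ i, 0 ≤ q i) (k : ℕ) {θ : ℝ} (hθ : 0 ≤ θ) :
    KyFanLE k (schmidtMatrix q) (∑ i, max (q i - θ) 0 + θ * k) := by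
  refine .of_projection (by positivity) fun P hP hPP _ ht => ?_
  have h1 : ‖bipartiteVec (schmidtMatrix q * P)‖ ^ 2 = ∑ i, q i * (P i i).re := by
    rw [← Complex.ofReal_re (‖bipartiteVec (schmidtMatrix q * P)‖ ^ 2), norm_sq_bipartiteVec,
      Matrix.conjTranspose_mul, hP, schmidtMatrix, Matrix.diagonal_conjTranspose,
      Matrix.mul_assoc, ← Matrix.mul_assoc (Matrix.diagonal _), Matrix.diagonal_mul_diagonal,
      Matrix.trace_mul_comm, Matrix.mul_assoc, hPP, Matrix.trace, Complex.re_sum]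
    refine Finset.sum_congr rfl fun i _ => ?_
    simp only [Matrix.diag, Matrix.diagonal_mul, Pi.star_apply, RCLike.star_def,
      Complex.conj_ofReal]
    rw [← Complex.ofReal_mul, Real.mul_self_sqrt (hq i), Complex.re_ofReal_mul]
  have h2 : ∀ i, (P i i).re = ∑ j, ‖P i j‖ ^ 2 := by
    intro i
    conv_lhs => rw [← hPP]
    rw [Matrix.mul_apply, Complex.re_sum]
    refine Finset.sum_congr rfl fun j _ => ?_
    have : P j i = star (P i j) := by conv_lhs => rw [← hP, Matrix.conjTranspose_apply]
    rw [this, RCLike.star_def, Complex.mul_conj, Complex.ofReal_re, Complex.normSq_eq_norm_sq]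
  have h0 : ∀ i, 0 ≤ (P i i).re := fun i => by rw [h2]; positivity
  have hle : ∀ i, (P i i).re ≤ 1 := by
    intro i
    -- A diagonal entry dominates its own square, hence is at most 1.
    have h3 : ‖P i i‖ ^ 2 ≤ (P i i).re := by
      rw [h2]
      exact Finset.single_le_sum (f := fun j => ‖P i j‖ ^ 2) (fun _ _ => by positivity)
        (Finset.mem_univ i)
    have h4 := Complex.re_le_norm (P i i)
    nlinarith [h0 i]
  have htr : ∑ i, (P i i).re ≤ k := by
    rw [← Complex.re_sum]; exact ht
  rw [h1]
  calc ∑ i, q i * (P i i).re = ∑ i, (q i - θ) * (P i i).re + θ * ∑ i, (P i i).re := by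
        rw [Finset.mul_sum, ← Finset.sum_add_distrib]
        exact Finset.sum_congr rfl fun i _ => by ring
    _ ≤ _ := by
        gcongr with i
        rcases le_total 0 (q i - θ) with h | h
        · rw [max_eq_left h]
          nlinarith [hle i]
        · rw [max_eq_right h]
          exact mul_nonpos_of_nonpos_of_nonneg h (h0 i)

/-- The coordinate projection onto `s` is an admissible test. -/
theorem KyFanLE.sum_le {A : Type} [Fintype A] [DecidableEq A] {p : A → ℝ}
    (hp : ∀ i, 0 ≤ p i) {k : ℕ} {c : ℝ} (h : KyFanLE k (schmidtMatrix p) c) {s : Finset A}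
    (hs : s.card ≤ k) : ∑ i ∈ s, p i ≤ c := by
  let P : Matrix A A ℂ := Matrix.diagonal fun i => if i ∈ s then 1 else 0
  have hP : P.conjTranspose = P := by
    simp only [P, Matrix.diagonal_conjTranspose]
    congr 1
    ext i
    by_cases hi : i ∈ s <;> simp [hi]
  have hPP : P * P = P := by simp [P, Matrix.diagonal_mul_diagonal]
  have hr : P.rank ≤ k := by
    rw [Matrix.rank_diagonal]
    refine le_trans (le_of_eq ?_) hs
    simp
  have h1 := h.norm_mul_projection_le hP hPP hr
  have h2 : schmidtMatrix p * P = schmidtMatrix fun i => if i ∈ s then p i else 0 := by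
    simp only [schmidtMatrix, P, Matrix.diagonal_mul_diagonal]
    congr 1
    ext i
    by_cases hi : i ∈ s <;> simp [hi]
  rw [h2, norm_schmidtMatrix fun i => by split_ifs; exacts [hp i, le_rfl]] at h1
  simpa using h1

theorem ketbra_bipartiteVec_apply {A B : Type} (M : Matrix A B ℂ) (x y : A × B) :
    ketbra (bipartiteVec M) x y = M x.1 x.2 * star (M y.1 y.2) := rfl

/-! ### From mixtures of permutations to LOCC protocols -/

/-- The sufficiency half of Nielsen's theorem: Alice measures, Bob applies a permutation. -/
theorem exists_isLOCC_of_mixture {A : Type} [Fintype A] [DecidableEq A] {p q : A → ℝ}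
    (hq : ∀ i, 0 ≤ q i) {w : Equiv.Perm A → ℝ} (hw : ∀ σ, 0 ≤ w σ) (hw1 : ∑ σ, w σ = 1)
    (hp : ∀ i, p i = ∑ σ, w σ * q (σ i)) :
    ∃ Φ : Matrix (A × A) (A × A) ℂ →ₗ[ℂ] Matrix (A × A) (A × A) ℂ, IsLOCC A A Φ ∧
      Φ (ketbra (bipartiteVec (schmidtMatrix p))) = ketbra (bipartiteVec (schmidtMatrix q)) := by
  have hp0 : ∀ i, 0 ≤ p i := fun i => by
    rw [hp]
    exact Finset.sum_nonneg fun σ _ => mul_nonneg (hw σ) (hq _)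
  -- Conditional probability of outcome `σ` given index `i`. Where `p i = 0` the value `w σ` keeps
  -- the sum over `σ` equal to 1, as completeness of the Kraus operators requires.
  let r : Equiv.Perm A → A → ℝ := fun σ i => if p i = 0 then w σ else w σ * q (σ i) / p i
  have hr0 : ∀ σ i, 0 ≤ r σ i := by
    intro σ i
    simp only [r]
    split_ifs
    exacts [hw σ, div_nonneg (mul_nonneg (hw σ) (hq _)) (hp0 i)]
  have hr1 : ∀ i, ∑ σ, r σ i = 1 := by
    intro i
    by_cases hi : p i = 0
    · simpa [r, hi] using hw1
    · simp only [r, hi, if_false]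
      rw [← Finset.sum_div, ← hp, div_self hi]
  have hrp : ∀ σ i, r σ i * p i = w σ * q (σ i) := by
    intro σ i
    by_cases hi : p i = 0
    · have h := hp i
      rw [hi, eq_comm, Finset.sum_eq_zero_iff_of_nonneg
        fun σ _ => mul_nonneg (hw σ) (hq _)] at h
      rw [hi, mul_zero, h σ (Finset.mem_univ _)]
    · simp only [r, hi, if_false]
      field_simp
  let U : Equiv.Perm A → Matrix A A ℂ := fun σ => Matrix.of fun x i => if x = σ i then 1 else 0
  have hU : ∀ σ, (U σ).conjTranspose * U σ = 1 := by
    intro σ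
    ext i j
    simp [U, Matrix.mul_apply, Matrix.one_apply, eq_comm]
  let K : Equiv.Perm A → Unit → Matrix A A ℂ := fun σ _ => U σ * schmidtMatrix (r σ)
  have hK : ∑ σ, ∑ j, (K σ j).conjTranspose * K σ j = 1 := by
    have : ∀ σ, (K σ ()).conjTranspose * K σ () = Matrix.diagonal fun i => (r σ i : ℂ) := by
      intro σ
      simp only [K, Matrix.conjTranspose_mul]
      rw [Matrix.mul_assoc, ← Matrix.mul_assoc (U σ).conjTranspose, hU, Matrix.one_mul,
        schmidtMatrix, Matrix.diagonal_conjTranspose, Matrix.diagonal_mul_diagonal]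
      congr 1
      ext i
      simp only [Pi.star_apply, RCLike.star_def, Complex.conj_ofReal]
      rw [← Complex.ofReal_mul, Real.mul_self_sqrt (hr0 σ i)]
    simp only [Finset.univ_unique, Finset.sum_singleton, PUnit.default_eq_unit, this]
    ext i j
    rw [Matrix.sum_apply, Matrix.one_apply]
    by_cases hij : i = j
    · subst hij
      simp only [Matrix.diagonal_apply_eq, if_true]
      exact_mod_cast hr1 i
    · simp [hij]
  refine ⟨_, .alice A A A (Equiv.Perm A) Unit K _ hK fun σ =>
    .bob A A A Unit Unit (fun _ _ => U σ) _ (by simp [hU σ]) fun _ => .done, ?_⟩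
  simp only [LinearMap.sum_apply, LinearMap.comp_apply, krausMap_alice, krausMap_bob,
    Finset.univ_unique, Finset.sum_singleton, PUnit.default_eq_unit, LinearMap.id_apply]
  -- After Alice's outcome `σ` and Bob's matching permutation, every branch is the target scaled by
  -- the square root of `w σ`, so the branches add up to the target projector.
  have hterm : ∀ σ, K σ () * schmidtMatrix p * (U σ).transpose =
      (Real.sqrt (w σ) : ℂ) • schmidtMatrix q := by
    intro σ
    have h1 : schmidtMatrix (r σ) * schmidtMatrix p =
        (Real.sqrt (w σ) : ℂ) • schmidtMatrix fun i => q (σ i) := by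
      simp only [schmidtMatrix, Matrix.diagonal_mul_diagonal]
      rw [← Matrix.diagonal_smul]
      congr 1
      ext i
      simp only [Pi.smul_apply, smul_eq_mul]
      rw [← Complex.ofReal_mul, ← Complex.ofReal_mul, ← Real.sqrt_mul (hr0 σ i), hrp,
        Real.sqrt_mul (hw σ)]
    simp only [K]
    rw [Matrix.mul_assoc (U σ), h1, Matrix.mul_smul, Matrix.smul_mul]
    congr 1
    ext i j
    rw [Matrix.mul_apply]
    simp only [U, schmidtMatrix, Matrix.mul_diagonal, Matrix.of_apply, Matrix.transpose_apply,
      Matrix.diagonal_apply]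
    rw [Equiv.sum_comp σ fun z => (if i = z then (1 : ℂ) else 0) * (Real.sqrt (q z) : ℂ) *
      if j = z then 1 else 0]
    by_cases hij : i = j
    · simp [hij]
    · simp [hij]
  simp only [hterm]
  ext x y
  have hs : ∀ σ, (Real.sqrt (w σ) : ℂ) * Real.sqrt (w σ) = w σ := fun σ => by
    rw [← Complex.ofReal_mul, Real.mul_self_sqrt (hw σ)]
  have hx : ∀ σ, ketbra (bipartiteVec ((Real.sqrt (w σ) : ℂ) • schmidtMatrix q)) x y =
      (w σ : ℂ) * ketbra (bipartiteVec (schmidtMatrix q)) x y := by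
    intro σ
    rw [ketbra_bipartiteVec_apply, ketbra_bipartiteVec_apply, Matrix.smul_apply, Matrix.smul_apply,
      smul_eq_mul, smul_eq_mul, star_mul', RCLike.star_def, Complex.conj_ofReal, mul_mul_mul_comm,
      hs]
  rw [Matrix.sum_apply, Finset.sum_congr rfl fun σ _ => hx σ]
  rw [← Finset.sum_mul, ← Complex.ofReal_sum, hw1, Complex.ofReal_one, one_mul]

/-! ### Conversions between composed Schmidt states -/

/-- The state with Schmidt vector `p` in the computational bases. -/
noncomputable def schmidtState {n : ℕ} (p : Fin n → ℝ) (hp : ∀ i, 0 ≤ p i)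
    (hp1 : ∑ i, p i = 1) : BipartiteState where
  A := Fin n
  B := Fin n
  proj := ketbra (bipartiteVec (schmidtMatrix p))
  isPure := ⟨_, by
    rw [← sq_eq_sq₀ (norm_nonneg _) zero_le_one, norm_schmidtMatrix hp, hp1, one_pow], rfl⟩

theorem hasSchmidtVector_schmidtState {n : ℕ} {p : Fin n → ℝ} (hp : ∀ i, 0 ≤ p i)
    (hp1 : ∑ i, p i = 1) : HasSchmidtVector (schmidtState p hp hp1) p := by
  refine ⟨(min_self _ |>.trans (Fintype.card_fin n)).symm, hp, fun i => EuclideanSpace.single i 1,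
    fun i => EuclideanSpace.single i 1, EuclideanSpace.orthonormal_single,
    EuclideanSpace.orthonormal_single, ?_⟩
  change ketbra (bipartiteVec (schmidtMatrix p)) = _
  congr 1
  ext ⟨x, y⟩
  change schmidtMatrix p x y = ∑ i, (Real.sqrt (p i) : ℂ) *
    (EuclideanSpace.single i (1 : ℂ) : EuclideanSpace ℂ (Fin n)) x *
    (EuclideanSpace.single i (1 : ℂ) : EuclideanSpace ℂ (Fin n)) y
  by_cases h : x = y
  · subst h; simp [schmidtMatrix]
  · simp [schmidtMatrix, h]

section

variable {n m n' m' : ℕ} {p : Fin n → ℝ} {hp : ∀ i, 0 ≤ p i} {hp1 : ∑ i, p i = 1}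
  {q : Fin m → ℝ} {hq : ∀ i, 0 ≤ q i} {hq1 : ∑ i, q i = 1}

theorem tensor_schmidtState_proj :
    ((schmidtState p hp hp1).tensor (schmidtState q hq hq1)).proj =
      ketbra (bipartiteVec (schmidtMatrix fun x : Fin n × Fin m => p x.1 * q x.2)) := by
  rw [← schmidtMatrix_kronecker hp]
  exact bipartiteKronecker_ketbra (schmidtMatrix p) (schmidtMatrix q)

variable {p' : Fin n' → ℝ} {hp' : ∀ i, 0 ≤ p' i} {hp1' : ∑ i, p' i = 1}
  {q' : Fin m' → ℝ} {hq' : ∀ i, 0 ≤ q' i} {hq1' : ∑ i, q' i = 1}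

/-- A violated Ky Fan inequality between the composed Schmidt vectors excludes a conversion. -/
theorem not_locctransforms_tensor (k : ℕ) {θ : ℝ} (hθ : 0 ≤ θ) (s : Finset (Fin n × Fin m))
    (hs : s.card ≤ k)
    (hlt : ∑ x : Fin n' × Fin m', max (p' x.1 * q' x.2 - θ) 0 + θ * k < ∑ x ∈ s, p x.1 * q x.2) :
    ¬ LOCCTransforms ((schmidtState p hp hp1).tensor (schmidtState q hq hq1))
      ((schmidtState p' hp' hp1').tensor (schmidtState q' hq' hq1')) := by
  rintro ⟨Φ, hΦ, h⟩
  rw [tensor_schmidtState_proj] at h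
  erw [tensor_schmidtState_proj] at h
  have hq0 : ∀ x : Fin n' × Fin m', 0 ≤ p' x.1 * q' x.2 := fun x => mul_nonneg (hp' _) (hq' _)
  have hnorm : ‖bipartiteVec (schmidtMatrix fun x : Fin n' × Fin m' => p' x.1 * q' x.2)‖ = 1 := by
    rw [← sq_eq_sq₀ (norm_nonneg _) zero_le_one, norm_schmidtMatrix hq0,
      Fintype.sum_prod_type, ← Finset.sum_mul_sum, hp1', hq1', one_pow, one_mul]
  have h1 : KyFanLE k (schmidtMatrix fun x : Fin n × Fin m => p x.1 * q x.2) _ :=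
    KyFanLE.of_isLOCC hΦ hnorm h (kyFanLE_schmidtMatrix hq0 k hθ)
  exact absurd (h1.sum_le (fun x => mul_nonneg (hp _) (hq _)) hs) (not_le.2 hlt)

end

section

variable {n m : ℕ} {p : Fin n → ℝ} {hp : ∀ i, 0 ≤ p i} {hp1 : ∑ i, p i = 1}
  {q : Fin m → ℝ} {hq : ∀ i, 0 ≤ q i} {hq1 : ∑ i, q i = 1}
  {p' : Fin n → ℝ} {hp' : ∀ i, 0 ≤ p' i} {hp1' : ∑ i, p' i = 1}
  {q' : Fin m → ℝ} {hq' : ∀ i, 0 ≤ q' i} {hq1' : ∑ i, q' i = 1}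

theorem locctransforms_tensor_of_mixture {w : Equiv.Perm (Fin n × Fin m) → ℝ} (hw : ∀ σ, 0 ≤ w σ)
    (hw1 : ∑ σ, w σ = 1)
    (h : ∀ x : Fin n × Fin m, p x.1 * q x.2 = ∑ σ, w σ * (p' (σ x).1 * q' (σ x).2)) :
    LOCCTransforms ((schmidtState p hp hp1).tensor (schmidtState q hq hq1))
      ((schmidtState p' hp' hp1').tensor (schmidtState q' hq' hq1')) := by
  obtain ⟨Φ, hΦ, h⟩ := exists_isLOCC_of_mixture (p := fun x : Fin n × Fin m => p x.1 * q x.2)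
    (q := fun x : Fin n × Fin m => p' x.1 * q' x.2)
    (fun x => mul_nonneg (hp' _) (hq' _)) hw hw1 h
  refine ⟨Φ, hΦ, ?_⟩
  rw [tensor_schmidtState_proj]
  erw [tensor_schmidtState_proj]
  exact h

/-- Birkhoff's theorem turns `D` into the mixture of permutations that the protocol needs. -/
theorem locctransforms_tensor_of_doublyStochastic
    {D : Matrix (Fin n × Fin m) (Fin n × Fin m) ℝ}
    (hD : D ∈ doublyStochastic ℝ (Fin n × Fin m))
    (h : ∀ x : Fin n × Fin m, p x.1 * q x.2 = ∑ y : Fin n × Fin m, D x y * (p' y.1 * q' y.2)) :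
    LOCCTransforms ((schmidtState p hp hp1).tensor (schmidtState q hq hq1))
      ((schmidtState p' hp' hp1').tensor (schmidtState q' hq' hq1')) := by
  obtain ⟨w, hw, hw1, hD'⟩ := exists_eq_sum_perm_of_mem_doublyStochastic hD
  refine locctransforms_tensor_of_mixture hw hw1 fun x => ?_
  rw [h, ← hD']
  simp only [Matrix.sum_apply, Matrix.smul_apply, smul_eq_mul, Finset.sum_mul]
  rw [Finset.sum_comm]
  refine Finset.sum_congr rfl fun σ _ => ?_
  simp [Equiv.Perm.permMatrix, PEquiv.toMatrix_apply]

end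

/-- The mixture is a single permutation, the exchange of the two indices. -/
theorem locctransforms_tensor_comm {n : ℕ} {p q : Fin n → ℝ} {hp : ∀ i, 0 ≤ p i}
    {hp1 : ∑ i, p i = 1} {hq : ∀ i, 0 ≤ q i} {hq1 : ∑ i, q i = 1} :
    LOCCTransforms ((schmidtState p hp hp1).tensor (schmidtState q hq hq1))
      ((schmidtState q hq hq1).tensor (schmidtState p hp hp1)) := by
  classical
  refine locctransforms_tensor_of_mixture (w := Pi.single (Equiv.prodComm _ _) 1)
    (fun σ => ?_) (by simp) fun x => ?_
  · by_cases h : σ = Equiv.prodComm _ _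
    · subst h; simp
    · simp [h]
  · rw [Finset.sum_eq_single (Equiv.prodComm _ _)]
    · simp [mul_comm]
    · intro σ _ h
      simp [h]
    · simp

/-! ### The numerical example -/

/-- Coarsening `Fin 4 × Fin 4` into blocks of sizes `4, 8, 4`, for the source. -/
def sourceBlock (x : Fin 4 × Fin 4) : Fin 3 :=
  -- The level sets of p ⊗ p, with values 0.16, 0.04 and 0.01.
  ![![0, 0, 1, 1], ![0, 0, 1, 1], ![1, 1, 2, 2], ![1, 1, 2, 2]] x.1 x.2

/-- Coarsening `Fin 4 × Fin 4` into blocks of sizes `4, 8, 4`, for the target. -/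
def targetBlock (x : Fin 4 × Fin 4) : Fin 3 :=
  -- Block 0 holds four largest entries of q ⊗ q (0.25, 0.145 twice, one 0.105), with sum 0.645;
  -- block 1 holds the other positive entries and three zeros, with sum 0.355; block 2 holds only
  -- zeros.
  ![![0, 0, 0, 1], ![0, 1, 1, 1], ![1, 1, 1, 1], ![2, 2, 2, 2]] x.1 x.2

theorem sum_sourceBlock (f : Fin 3 → ℝ) :
    ∑ x, f (sourceBlock x) = 4 * f 0 + 8 * f 1 + 4 * f 2 := by
  simp [Fintype.sum_prod_type, Fin.sum_univ_four, sourceBlock]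
  ring

theorem sum_targetBlock (f : Fin 3 → ℝ) :
    ∑ x, f (targetBlock x) = 4 * f 0 + 8 * f 1 + 4 * f 2 := by
  simp [Fintype.sum_prod_type, Fin.sum_univ_four, targetBlock]
  ring

/-- The entries of a block-constant doubly stochastic matrix with blocks of sizes `4, 8, 4`. -/
noncomputable def blockWeight : Matrix (Fin 3) (Fin 3) ℝ :=
  -- With a symmetric matrix and corner 0, the outer rows are fixed by row sum 1 and the source
  -- values 0.16 and 0.01; the middle entry then follows from its row sum. Symmetry yields the
  -- column sums, as both coarsenings have the same block sizes.
  !![185/748, 1/748, 0; 1/748, 5855/53108, 2/71; 0, 2/71, 55/284]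

theorem blockMatrix_mem_doublyStochastic :
    (Matrix.of fun x y => blockWeight (sourceBlock x) (targetBlock y)) ∈
      doublyStochastic ℝ (Fin 4 × Fin 4) := by
  rw [mem_doublyStochastic_iff_sum]
  refine ⟨fun x y => ?_, fun x => ?_, fun y => ?_⟩
  · simp only [Matrix.of_apply]
    generalize sourceBlock x = i
    generalize targetBlock y = j
    fin_cases i <;> fin_cases j <;> norm_num [blockWeight]
  · simp only [Matrix.of_apply]
    rw [sum_targetBlock fun j => blockWeight (sourceBlock x) j]
    generalize sourceBlock x = i
    fin_cases i <;> simp [blockWeight] <;> norm_num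
  · simp only [Matrix.of_apply]
    rw [sum_sourceBlock fun i => blockWeight i (targetBlock y)]
    generalize targetBlock y = i
    fin_cases i <;> simp [blockWeight] <;> norm_num

theorem sum_targetBlock_mul (f : Fin 3 → ℝ) :
    ∑ y : Fin 4 × Fin 4, f (targetBlock y) *
      ((![0.5, 0.29, 0.21, 0] : Fin 4 → ℝ) y.1 * (![0.5, 0.29, 0.21, 0] : Fin 4 → ℝ) y.2) =
      0.645 * f 0 + 0.355 * f 1 := by
  simp [Fintype.sum_prod_type, Fin.sum_univ_four, targetBlock]
  ring

theorem source_eq_sum_blockWeight (x : Fin 4 × Fin 4) :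
    (![0.4, 0.4, 0.1, 0.1] : Fin 4 → ℝ) x.1 * (![0.4, 0.4, 0.1, 0.1] : Fin 4 → ℝ) x.2 =
      ∑ y : Fin 4 × Fin 4, blockWeight (sourceBlock x) (targetBlock y) *
        ((![0.5, 0.29, 0.21, 0] : Fin 4 → ℝ) y.1 * (![0.5, 0.29, 0.21, 0] : Fin 4 → ℝ) y.2) := by
  rw [sum_targetBlock_mul (blockWeight (sourceBlock x))]
  have h : (![0.4, 0.4, 0.1, 0.1] : Fin 4 → ℝ) x.1 * (![0.4, 0.4, 0.1, 0.1] : Fin 4 → ℝ) x.2 =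
      ![0.16, 0.04, 0.01] (sourceBlock x) := by
    obtain ⟨i, j⟩ := x
    fin_cases i <;> fin_cases j <;> simp [sourceBlock] <;> norm_num
  rw [h]
  generalize sourceBlock x = i
  fin_cases i <;> simp [blockWeight] <;> norm_num

theorem theorem5p3 :
    ∃ (S : Set BipartiteState) (ψ₁ ψ₂ : BipartiteState),
      S = {ψ₁, ψ₂} ∧ S.ncard = 2 ∧
      HasSchmidtVector ψ₁ ![(0.4 : ℝ), 0.4, 0.1, 0.1] ∧
      HasSchmidtVector ψ₂ ![(0.5 : ℝ), 0.29, 0.21, 0] ∧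
      (ψ₁, ψ₂) ∈ flexCatLOCC S \ ⋃ c ∈ S, catLOCC c := by
  have hp : ∀ i, 0 ≤ (![0.4, 0.4, 0.1, 0.1] : Fin 4 → ℝ) i := by
    intro i
    fin_cases i <;> norm_num
  have hp1 : ∑ i, (![0.4, 0.4, 0.1, 0.1] : Fin 4 → ℝ) i = 1 := by
    simp [Fin.sum_univ_four]
    norm_num
  have hq : ∀ i, 0 ≤ (![0.5, 0.29, 0.21, 0] : Fin 4 → ℝ) i := by
    intro i
    fin_cases i <;> norm_num
  have hq1 : ∑ i, (![0.5, 0.29, 0.21, 0] : Fin 4 → ℝ) i = 1 := by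
    simp [Fin.sum_univ_four]
    norm_num
  have h₁ : LOCCTransforms ((schmidtState _ hp hp1).tensor (schmidtState _ hp hp1))
      ((schmidtState _ hq hq1).tensor (schmidtState _ hq hq1)) :=
    locctransforms_tensor_of_doublyStochastic blockMatrix_mem_doublyStochastic
      source_eq_sum_blockWeight
  have hn₁ : ¬ LOCCTransforms ((schmidtState _ hp hp1).tensor (schmidtState _ hp hp1))
      ((schmidtState _ hq hq1).tensor (schmidtState _ hp hp1)) := by
    -- Here 0.1 separates the fourth and fifth entries 0.116 and 0.084 of q ⊗ p, so the bound is its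
    -- top-four sum 0.632, below 4 · 0.16 = 0.64.
    refine not_locctransforms_tensor 4 (θ := 0.1) (by norm_num)
      {(0, 0), (0, 1), (1, 0), (1, 1)} (by decide) ?_
    simp [Fintype.sum_prod_type, Fin.sum_univ_four]
    norm_num
  have hn₂ : ¬ LOCCTransforms ((schmidtState _ hp hp1).tensor (schmidtState _ hq hq1))
      ((schmidtState _ hq hq1).tensor (schmidtState _ hq hq1)) := by
    -- Here 0.145 is the second largest entry of q ⊗ q, so the bound is 0.25 + 0.145 = 0.395, below
    -- 0.2 + 0.2 = 0.4.
    refine not_locctransforms_tensor 2 (θ := 0.145) (by norm_num) {(0, 0), (1, 0)} (by decide) ?_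
    simp [Fintype.sum_prod_type, Fin.sum_univ_four]
    norm_num
  -- If the states coincided, the achieved conversion would be the excluded one.
  have hne : schmidtState _ hp hp1 ≠ schmidtState _ hq hq1 := by
    intro h
    rw [← h] at h₁ hn₁
    exact hn₁ h₁
  refine ⟨_, schmidtState _ hp hp1, schmidtState _ hq hq1, rfl, Set.ncard_pair hne,
    hasSchmidtVector_schmidtState hp hp1, hasSchmidtVector_schmidtState hq hq1, ?_, ?_⟩
  · rintro c (rfl | rfl)
    · exact ⟨_, Or.inr rfl, h₁⟩
    · exact ⟨_, Or.inl rfl, locctransforms_tensor_comm⟩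
  · simp only [Set.mem_iUnion, not_exists]
    rintro c (rfl | rfl)
    exacts [hn₁, hn₂]
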